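/- All graphs are finite and simple. A graph \(H\) is a minor of a graph \(G\) if a graph isomorphic to \(H\) can be obtained from \(G\) by repeatedly deleting vertices, deleting edges and contracting edges. For real \(m\), a graph \(G\) is \(m\)-minor-universal if every graph with at most \(m\) edges and no isolated vertices is a minor of \(G\). The product \(\times\) is the Cartesian (box) product of graphs, in which two tuples are adjacent if they are adjacent in one coordinate and equal in all the others, and \(C_\ell\) is the cycle with \(\ell\) vertices. Theorem B. (1) Let \(k\) and \(n\ge 1\) be natural numbers, let \(G_1,\dots,G_n\) be connected graphs, each with at most \(k\) vertices, let \(H_4\) be any connected graph with \(4\) vertices and \(H_k\) any connected graph with \(k\) vertices. Then the graph \[ H_4\times C_{6n-2}\times H_k\times G_1\times\cdots\times G_n \] is \(\frac{1}{16}|V(G_1)|\cdots|V(G_n)|\)-minor-universal. (2) For every natural number \(k\ge 2\) there is a constant \(C=C(k)>0\), depending only on \(k\), such that for every \(n\ge 1\) and all graphs \(G_1,\dots,G_n\) (not necessarily connected), each with at most \(k\) vertices, the graph \(G_1\times\cdots\times G_n\) is not \(\frac{Ck^n}{\sqrt n}\)-minor-universal. -/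

import Mathlib

namespace ProductMinors

universe u v

/-- Contraction of the edge `uv` of `G`: the vertices `u` and `v` are identified. The vertex `u`
plays the role of the new vertex (and `v` is dropped), so `u` becomes adjacent to all the other
neighbours of `u` and of `v`. -/
def contractEdge {V : Type u} (G : SimpleGraph V) (u v : V) : SimpleGraph {x : V // x ≠ v} where
  Adj a b := a ≠ b ∧
    (G.Adj a.1 b.1 ∨ (a.1 = u ∧ G.Adj v b.1) ∨ (b.1 = u ∧ G.Adj v a.1))
  symm := ⟨fun _ _ h => ⟨h.1.symm, h.2.elim (fun h => Or.inl h.symm)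
    (fun h => Or.inr h.symm)⟩⟩
  loopless := ⟨fun _ h => h.1 rfl⟩

/-- `IsMinor H G` : the graph `H` is a minor of the graph `G`, i.e. by repeatedly deleting vertices
and edges from `G`, as well as contracting edges, one can obtain a graph isomorphic to `H`. -/
inductive IsMinor {W : Type v} (H : SimpleGraph W) : {V : Type u} → SimpleGraph V → Prop
  | of_iso {V : Type u} {G : SimpleGraph V} (e : G ≃g H) : IsMinor H G
  | delete_vertex {V : Type u} {G : SimpleGraph V} (x : V)
      (h : IsMinor H (G.induce {y | y ≠ x})) : IsMinor H G
  | delete_edge {V : Type u} {G : SimpleGraph V} (e : Sym2 V) (he : e ∈ G.edgeSet)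
      (h : IsMinor H (G.deleteEdges {e})) : IsMinor H G
  | contract_edge {V : Type u} {G : SimpleGraph V} (x y : V) (hxy : G.Adj x y)
      (h : IsMinor H (contractEdge G x y)) : IsMinor H G

/-- `G` is `m`-minor-universal: every finite graph with at most `m` edges and with no isolated
vertices is a minor of `G`. (Up to isomorphism every finite graph lives in `Type`.) -/
def IsMinorUniversal {V : Type u} (G : SimpleGraph V) (m : ℝ) : Prop :=
  ∀ (W : Type) [Finite W] (H : SimpleGraph W),
    (∀ w : W, ∃ w' : W, H.Adj w w') → (H.edgeSet.ncard : ℝ) ≤ m → IsMinor H G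

/-- The Cartesian product `G₁ × ⋯ × Gₙ` of a family of graphs: two tuples are adjacent if they are
adjacent in one coordinate and agree in all the others. -/
def boxPi {ι : Type v} {V : ι → Type u} (G : ∀ i, SimpleGraph (V i)) :
    SimpleGraph (∀ i, V i) where
  Adj x y := ∃ i, (G i).Adj (x i) (y i) ∧ ∀ j, j ≠ i → x j = y j
  symm := ⟨fun _ _ ⟨i, h, h'⟩ => ⟨i, h.symm, fun j hj => (h' j hj).symm⟩⟩
  loopless := ⟨fun _ ⟨i, h, _⟩ => (G i).loopless.irrefl _ h⟩

end ProductMinors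

/-!
Part (1). By repeated edge colouring of regular bipartite graphs, every permutation of a product
of `n` finite sets is a product of `2 * n - 1` permutations each of which changes only one
coordinate. One of these is routed through three consecutive copies of `Hₖ × G₁ × ⋯ × Gₙ`, so the
tuples can be permuted at will along the cycle, and since the cycle closes up, the tuples can be
merged into connected sets according to any partition. Take two copies of this product joined by
an edge of `H₄`, and tuples representing the darts of `H`: merging the darts by their initial
vertex in one copy and by their edge in the other copy yields `H` as a minor.

Part (2). Fix a vertex of every `Gᵢ`, and let the level of a tuple be the number of its
coordinates that are the fixed vertex. Adjacent tuples have levels differing by at most one, and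
by Fourier inversion a level has only `O(k ^ n / √n)` elements. Deleting a level in the middle
therefore separates the branch sets of a minor with more vertices than that into two large parts
without an edge in between, which is impossible for a sparse random graph.
-/

namespace ProductMinors

section Models

variable {V V' W W' : Type*} {G : SimpleGraph V} {G' : SimpleGraph V'} {H : SimpleGraph W}

theorem reachable_map_of_forall_adj {φ : V → V'}
    (hφ : ∀ a b, G.Adj a b → G'.Reachable (φ a) (φ b)) {x y : V} (h : G.Reachable x y) :
    G'.Reachable (φ x) (φ y) := by
  obtain ⟨p⟩ := h
  induction p with
  | nil => exact .rfl
  | cons hab _ ih => exact (hφ _ _ hab).trans ih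

/-- The subgraph of `G` whose edges are the edges of `G` inside the fibre `f ⁻¹' {some w}`. It lives
on all of `V`, so that no subtypes are needed to speak of paths inside a fibre. -/
def fiberGraph (G : SimpleGraph V) (f : V → Option W) (w : W) : SimpleGraph V where
  Adj x y := G.Adj x y ∧ f x = some w ∧ f y = some w
  symm := ⟨fun _ _ h => ⟨h.1.symm, h.2.2, h.2.1⟩⟩
  loopless := ⟨fun _ h => h.1.ne rfl⟩

theorem reachable_fiberGraph_of_adj {f : V → Option W} {w : W} {x y : V} (h : G.Adj x y)
    (hx : f x = some w) (hy : f y = some w) : (fiberGraph G f w).Reachable x y :=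
  SimpleGraph.Adj.reachable ⟨h, hx, hy⟩

theorem reachable_fiberGraph_map {f : V → Option W} {f' : V' → Option W'} {w : W} {w' : W'}
    (φ : G →g G') (hf : ∀ a, f a = some w → f' (φ a) = some w') {x y : V}
    (h : (fiberGraph G f w).Reachable x y) : (fiberGraph G' f' w').Reachable (φ x) (φ y) := by
  refine reachable_map_of_forall_adj (fun a b hab => ?_) h
  obtain ⟨hab, ha, hb⟩ := hab
  exact reachable_fiberGraph_of_adj (φ.map_adj hab) (hf a ha) (hf b hb)

/-- A partial labelling `f` of the vertices of `G` by disjoint connected sets of vertices: the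
vertices with value `none` are unlabelled, and a label may be unused. -/
def FiberConnected (G : SimpleGraph V) (f : V → Option W) : Prop :=
  ∀ ⦃w x y⦄, f x = some w → f y = some w → (fiberGraph G f w).Reachable x y

theorem FiberConnected.bind {f : V → Option V'} {g : V' → Option W} (hf : FiberConnected G f)
    (hg : FiberConnected G' g)
    (hadj : ∀ ⦃u v⦄, G'.Adj u v → ∃ x y, f x = some u ∧ f y = some v ∧ G.Adj x y) :
    FiberConnected G fun x => (f x).bind g := by
  intro w x y hx hy
  obtain ⟨u, hxu, hu⟩ := Option.bind_eq_some_iff.1 hx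
  obtain ⟨v, hyv, hv⟩ := Option.bind_eq_some_iff.1 hy
  have within {u x y} (hu : g u = some w) (hx : f x = some u) (hy : f y = some u) :
      (fiberGraph G (fun x => (f x).bind g) w).Reachable x y :=
    reachable_fiberGraph_map .id (fun a (ha : f a = _) => by simp [ha, hu]) (hf hx hy)
  obtain ⟨p⟩ := hg hu hv
  clear hx hu
  induction p generalizing x with
  | nil => exact within hv hxu hyv
  | cons huv _ ih =>
    obtain ⟨huv, hu, hu'⟩ := huv
    obtain ⟨a, b, ha, hb, hab⟩ := hadj huv
    have edge : (fiberGraph G (fun x => (f x).bind g) w).Reachable a b :=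
      reachable_fiberGraph_of_adj hab (by simp [ha, hu]) (by simp [hb, hu'])
    exact (within hu hxu ha).trans (edge.trans (ih hb hyv hv))

theorem FiberConnected.bind_of_injOn {f : V → Option V'} (hf : FiberConnected G f)
    {g : V' → Option W} (hg : ∀ ⦃u v w⦄, g u = some w → g v = some w → u = v) :
    FiberConnected G fun x => (f x).bind g := by
  refine hf.bind (G' := ⊥) (fun w u v hu hv => ?_) (by simp)
  rw [hg hu hv]

theorem FiberConnected.of_forall_exists_hom {f : V → Option W} {K : SimpleGraph V'}
    (hK : K.Connected) (h : ∀ w, ∃ φ : K →g G, (∀ a, f (φ a) = some w) ∧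
      ∀ x, f x = some w → x ∈ Set.range φ) : FiberConnected G f := by
  intro w x y hx hy
  obtain ⟨φ, hφ, hsurj⟩ := h w
  obtain ⟨a, rfl⟩ := hsurj x hx
  obtain ⟨b, rfl⟩ := hsurj y hy
  exact reachable_map_of_forall_adj
    (fun c d hcd => reachable_fiberGraph_of_adj (φ.map_adj hcd) (hφ c) (hφ d)) (hK.preconnected a b)

theorem FiberConnected.exists_adj {f : V → Option W} (hf : FiberConnected G f) {x y : V} {w : W}
    (hx : f x = some w) (hy : f y = some w) (hne : x ≠ y) : ∃ z, G.Adj x z ∧ f z = some w := by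
  obtain ⟨p⟩ := hf hx hy
  cases p with
  | nil => exact absurd rfl hne
  | cons hxz _ => exact ⟨_, hxz.1, hxz.2.2⟩

/-- The fibres of the partial labelling `f` of the vertices of `G` are the branch sets of a model
of the minor `H`. -/
structure IsModel (H : SimpleGraph W) (G : SimpleGraph V) (f : V → Option W) : Prop where
  surj : ∀ w, ∃ x, f x = some w
  conn : FiberConnected G f
  adj : ∀ {w w'}, H.Adj w w' → ∃ x y, f x = some w ∧ f y = some w' ∧ G.Adj x y

theorem IsModel.trans {g : V' → Option W} {f : V → Option V'} (hg : IsModel H G' g)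
    (hf : IsModel G' G f) : IsModel H G fun x => (f x).bind g := by
  refine ⟨fun w => ?_, hf.conn.bind hg.conn fun _ _ => hf.adj, fun {w w'} hw => ?_⟩
  · obtain ⟨u, hu⟩ := hg.surj w
    obtain ⟨x, hx⟩ := hf.surj u
    exact ⟨x, by simp [hx, hu]⟩
  · obtain ⟨u, v, hu, hv, huv⟩ := hg.adj hw
    obtain ⟨a, b, ha, hb, hab⟩ := hf.adj huv
    exact ⟨a, b, by simp [ha, hu], by simp [hb, hv], hab⟩

theorem fiberConnected_partialInv {φ : W → V} (hφ : Function.Injective φ) :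
    FiberConnected G (Function.partialInv φ) := by
  intro w x y hx hy
  rw [← (hφ.isPartialInv _ _).1 hx, ← (hφ.isPartialInv _ _).1 hy]

theorem isModel_partialInv (φ : H →g G) (hφ : Function.Injective φ) :
    IsModel H G (Function.partialInv φ) :=
  ⟨fun w => ⟨φ w, Function.partialInv_left hφ w⟩, fiberConnected_partialInv hφ, fun {w w'} hw =>
    ⟨φ w, φ w', Function.partialInv_left hφ w, Function.partialInv_left hφ w', φ.map_adj hw⟩⟩

end Models

section Minors

variable {V W : Type*} {G : SimpleGraph V} {H : SimpleGraph W} {x y : V}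

open Classical in
/-- The projection from the vertices of `G` to those of the contraction of the edge `xy`. -/
noncomputable def contractMap (hxy : x ≠ y) (z : V) : {z : V // z ≠ y} :=
  if h : z = y then ⟨x, hxy⟩ else ⟨z, h⟩

theorem contractMap_self (hxy : x ≠ y) : contractMap hxy y = ⟨x, hxy⟩ := dif_pos rfl

theorem contractMap_of_ne (hxy : x ≠ y) {z : V} (hz : z ≠ y) : contractMap hxy z = ⟨z, hz⟩ :=
  dif_neg hz

theorem contractMap_coe (hxy : x ≠ y) (z : {z : V // z ≠ y}) : contractMap hxy z = z :=
  contractMap_of_ne hxy z.2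

theorem eq_or_adj_of_contractMap_eq (hxy : G.Adj x y) {a b : V}
    (hab : contractMap hxy.ne a = contractMap hxy.ne b) : a = b ∨ G.Adj a b := by
  simp only [contractMap] at hab
  grind [SimpleGraph.Adj.symm]

theorem contractEdge_adj_contractMap (hxy : x ≠ y) {a b : V} (hab : G.Adj a b)
    (hne : contractMap hxy a ≠ contractMap hxy b) :
    (contractEdge G x y).Adj (contractMap hxy a) (contractMap hxy b) := by
  refine ⟨hne, ?_⟩
  simp only [contractMap] at hne ⊢
  grind [SimpleGraph.Adj.symm]

theorem exists_adj_of_contractEdge_adj (hxy : x ≠ y) {a b : {z : V // z ≠ y}}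
    (hab : (contractEdge G x y).Adj a b) :
    ∃ a' b', contractMap hxy a' = a ∧ contractMap hxy b' = b ∧ G.Adj a' b' := by
  obtain ⟨-, hab | ⟨hax, hyb⟩ | ⟨hbx, hya⟩⟩ := hab
  · exact ⟨a, b, contractMap_coe hxy a, contractMap_coe hxy b, hab⟩
  · exact ⟨y, b, (contractMap_self hxy).trans (Subtype.ext hax.symm), contractMap_coe hxy b, hyb⟩
  · exact ⟨a, y, contractMap_coe hxy a, (contractMap_self hxy).trans (Subtype.ext hbx.symm),
      hya.symm⟩

theorem isModel_contractEdge (hxy : G.Adj x y) :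
    IsModel (contractEdge G x y) G fun z => some (contractMap hxy.ne z) := by
  refine ⟨fun w => ⟨w, by rw [contractMap_coe]⟩, fun w a b ha hb => ?_, fun hw => ?_⟩
  · obtain rfl | hab := eq_or_adj_of_contractMap_eq hxy (Option.some.inj (ha.trans hb.symm))
    · exact .rfl
    · exact reachable_fiberGraph_of_adj hab ha hb
  · simpa only [Option.some.injEq] using exists_adj_of_contractEdge_adj hxy.ne hw

theorem IsMinor.exists_isModel (h : IsMinor H G) : ∃ f, IsModel H G f := by
  induction h with
  | @of_iso V G e => exact ⟨_, isModel_partialInv e.symm.toHom e.symm.injective⟩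
  | delete_vertex x _ ih =>
    obtain ⟨f, hf⟩ := ih
    exact ⟨_, hf.trans (isModel_partialInv (SimpleGraph.Embedding.induce _).toHom
      Subtype.val_injective)⟩
  | delete_edge e _ _ ih =>
    obtain ⟨f, hf⟩ := ih
    exact ⟨_, hf.trans (isModel_partialInv (.ofLE (SimpleGraph.deleteEdges_le _))
      Function.injective_id)⟩
  | contract_edge x y hxy _ ih =>
    obtain ⟨f, hf⟩ := ih
    exact ⟨_, hf.trans (isModel_contractEdge hxy)⟩

theorem isMinor_of_equiv [Finite V] (e : V ≃ W) (h : ∀ x y, H.Adj (e x) (e y) → G.Adj x y) :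
    IsMinor H G := by
  induction hm : G.edgeSet.ncard using Nat.strong_induction_on generalizing G with
  | _ m ih =>
    by_cases hG : ∀ x y, G.Adj x y → H.Adj (e x) (e y)
    · exact .of_iso ⟨e, fun {x y} => ⟨h x y, hG x y⟩⟩
    push Not at hG
    obtain ⟨x, y, hxy, hn⟩ := hG
    refine .delete_edge s(x, y) hxy (ih _ ?_ (fun a b hab => ?_) rfl)
    · rw [SimpleGraph.edgeSet_deleteEdges, ← hm]
      exact Set.ncard_sdiff_singleton_lt_of_mem hxy
    · refine SimpleGraph.deleteEdges_adj.2 ⟨h a b hab, fun hs => ?_⟩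
      obtain ⟨rfl, rfl⟩ | ⟨rfl, rfl⟩ := Sym2.eq_iff.1 (Set.mem_singleton_iff.1 hs)
      exacts [hn hab, hn hab.symm]

theorem IsModel.induce_ne {f : V → Option W} (hf : IsModel H G f) (hx : f x = none) :
    IsModel H (G.induce {y | y ≠ x}) fun z => f z := by
  have hne {z w} (hz : f z = some w) : z ≠ x := by
    rintro rfl
    simp [hx] at hz
  have lift {w a b} (p : (fiberGraph G f w).Walk a b) (ha : a ≠ x) (hb : b ≠ x) :
      (fiberGraph (G.induce {y | y ≠ x}) (fun z => f z) w).Reachable ⟨a, ha⟩ ⟨b, hb⟩ := by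
    induction p with
    | nil => exact .rfl
    | cons hab _ ih =>
      exact (reachable_fiberGraph_of_adj (SimpleGraph.induce_adj.2 hab.1) hab.2.1 hab.2.2).trans
        (ih (hne hab.2.2) hb)
  refine ⟨fun w => ?_, fun w a b ha hb => ?_, fun hw => ?_⟩
  · obtain ⟨z, hz⟩ := hf.surj w
    exact ⟨⟨z, hne hz⟩, hz⟩
  · obtain ⟨p⟩ := hf.conn ha hb
    exact lift p a.2 b.2
  · obtain ⟨a, b, ha, hb, hab⟩ := hf.adj hw
    exact ⟨⟨a, hne ha⟩, ⟨b, hne hb⟩, ha, hb, hab⟩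

theorem IsModel.contract {f : V → Option W} (hf : IsModel H G f) (hxy : x ≠ y) (hfxy : f x = f y) :
    IsModel H (contractEdge G x y) fun z => f z := by
  have hc (z : V) : f (contractMap hxy z) = f z := by
    obtain rfl | hz := eq_or_ne z y
    · rw [contractMap_self, hfxy]
    · rw [contractMap_of_ne hxy hz]
  refine ⟨fun w => ?_, fun w a b ha hb => ?_, fun {w w'} hw => ?_⟩
  · obtain ⟨z, hz⟩ := hf.surj w
    exact ⟨contractMap hxy z, (hc z).trans hz⟩
  · rw [← contractMap_coe hxy a, ← contractMap_coe hxy b]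
    refine reachable_map_of_forall_adj (fun u v huv => ?_) (hf.conn ha hb)
    obtain ⟨huv, hu, hv⟩ := huv
    obtain hne | hne := eq_or_ne (contractMap hxy u) (contractMap hxy v)
    · rw [hne]
    · exact reachable_fiberGraph_of_adj (contractEdge_adj_contractMap hxy huv hne)
        ((hc u).trans hu) ((hc v).trans hv)
  · obtain ⟨a, b, ha, hb, hab⟩ := hf.adj hw
    refine ⟨contractMap hxy a, contractMap hxy b, (hc a).trans ha, (hc b).trans hb,
      contractEdge_adj_contractMap hxy hab fun hne => hw.ne (Option.some.inj ?_)⟩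
    rw [← ha, ← hb, ← hc a, ← hc b, hne]

theorem IsModel.isMinor [Finite V] {f : V → Option W} (hf : IsModel H G f) : IsMinor H G := by
  induction hm : Nat.card V using Nat.strong_induction_on generalizing V with
  | _ m ih =>
    have hlt (y : V) : Nat.card {z : V // z ≠ y} < m :=
      hm ▸ Finite.card_subtype_lt (x := y) (not_not.2 rfl)
    by_cases hnone : ∃ x, f x = none
    · obtain ⟨x, hx⟩ := hnone
      exact .delete_vertex x (ih _ (hlt x) (hf.induce_ne hx) rfl)
    push Not at hnone
    choose g hg using fun x => Option.ne_none_iff_exists'.1 (hnone x)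
    by_cases hinj : Function.Injective g
    · have hsurj : Function.Surjective g := fun w =>
        (hf.surj w).imp fun x hx => Option.some.inj ((hg x).symm.trans hx)
      refine isMinor_of_equiv (Equiv.ofBijective g ⟨hinj, hsurj⟩) fun x y hxy => ?_
      obtain ⟨a, b, ha, hb, hab⟩ := hf.adj hxy
      rw [hg] at ha hb
      rwa [← hinj (Option.some.inj ha), ← hinj (Option.some.inj hb)]
    · simp only [Function.Injective, not_forall] at hinj
      obtain ⟨x, y, hxy, hne⟩ := hinj
      obtain ⟨z, hxz, hz⟩ := hf.conn.exists_adj (hg x) (hxy ▸ hg y) hne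
      exact .contract_edge x z hxz (ih _ (hlt z) (hf.contract hxz.ne ((hg x).trans hz.symm)) rfl)

end Minors

section EdgeColouring

variable {E Y : Type*}

theorem ncard_preimage_notMem_range {s : E → Y} {d : ℕ} (hs : ∀ y, (s ⁻¹' {y}).ncard = d + 1)
    {m : Y → E} (hm : Function.Bijective (s ∘ m)) (y : Y) :
    ((fun e : {e // e ∉ Set.range m} => s e) ⁻¹' {y}).ncard = d := by
  obtain ⟨y, rfl⟩ := hm.surjective y
  rw [← Set.ncard_image_of_injective _ Subtype.val_injective]
  have : Subtype.val '' ((fun e : {e // e ∉ Set.range m} => s e) ⁻¹' {(s ∘ m) y}) =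
      s ⁻¹' {(s ∘ m) y} \ {m y} := by
    ext e
    simp only [Set.mem_image, Set.mem_preimage, Set.mem_singleton_iff, Subtype.exists,
      exists_and_left, exists_prop, exists_eq_right_right, Set.mem_sdiff]
    refine and_congr_right fun he => not_congr ⟨?_, fun h => ⟨y, h.symm⟩⟩
    rintro ⟨y', rfl⟩
    rw [hm.injective he]
  rw [this, Set.ncard_sdiff_singleton_of_mem (by simp), hs, Nat.add_sub_cancel]

variable [Finite E]

theorem ncard_preimage_eq_mul {s : E → Y} {d : ℕ} (hs : ∀ y, (s ⁻¹' {y}).ncard = d)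
    (A : Finset Y) : (s ⁻¹' A).ncard = A.card * d := by
  classical
  have := Fintype.ofFinite E
  have hcard (B : Finset Y) : (s ⁻¹' B).ncard = Finset.card {e | s e ∈ B} := by
    rw [← Set.ncard_coe_finset, Finset.coe_filter_univ]
    rfl
  have hone (y : Y) : Finset.card {e | s e = y} = d := by
    rw [← hs y, ← Finset.coe_singleton, hcard]
    simp only [Finset.mem_singleton]
  rw [hcard, ← Finset.sum_card_fiberwise_eq_card_filter, Finset.sum_const_nat fun y _ => hone y]

theorem exists_bijective_comp_transversal [Finite Y] {s t : E → Y} {d : ℕ} (hd : 0 < d)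
    (hs : ∀ y, (s ⁻¹' {y}).ncard = d) (ht : ∀ y, (t ⁻¹' {y}).ncard = d) :
    ∃ m : Y → E, Function.Bijective (s ∘ m) ∧ Function.Bijective (t ∘ m) := by
  classical
  have := Fintype.ofFinite Y
  have hall (A : Finset Y) : A.card ≤ Finset.card {y | ∃ x ∈ A, ∃ e, s e = x ∧ t e = y} := by
    refine Nat.le_of_mul_le_mul_right ?_ hd
    rw [← ncard_preimage_eq_mul hs, ← ncard_preimage_eq_mul ht]
    refine Set.ncard_le_ncard fun e he => ?_
    exact Finset.mem_filter.2 ⟨Finset.mem_univ _, _, he, e, rfl, rfl⟩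
  obtain ⟨f, hf, hst⟩ := (Fintype.all_card_le_filter_rel_iff_exists_injective _).1 hall
  choose m hsm htm using hst
  obtain rfl : t ∘ m = f := funext htm
  obtain hid : s ∘ m = id := funext hsm
  exact ⟨m, hid ▸ Function.bijective_id, Finite.injective_iff_bijective.1 hf⟩

/-- König's edge colouring theorem, for the bipartite multigraph in which `e` joins `s e` to
`t e`. -/
theorem exists_edgeColouring [Finite Y] {s t : E → Y} {d : ℕ}
    (hs : ∀ y, (s ⁻¹' {y}).ncard = d) (ht : ∀ y, (t ⁻¹' {y}).ncard = d) : ∃ c : E → Fin d,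
      (Function.Injective fun e => (s e, c e)) ∧ Function.Injective fun e => (t e, c e) := by
  classical
  induction d generalizing E with
  | zero =>
    have : IsEmpty E := ⟨fun e => by
      have h := (Set.ncard_eq_zero (Set.toFinite _)).1 (hs (s e))
      exact (h ▸ rfl : e ∈ (∅ : Set E))⟩
    exact ⟨isEmptyElim, fun e => isEmptyElim e, fun e => isEmptyElim e⟩
  | succ d ih =>
    obtain ⟨m, hsm, htm⟩ := exists_bijective_comp_transversal d.succ_pos hs ht
    obtain ⟨c, hsc, htc⟩ := ih (ncard_preimage_notMem_range hs hsm)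
      (ncard_preimage_notMem_range ht htm)
    let c' (e : E) : Fin (d + 1) :=
      if he : e ∈ Set.range m then Fin.last d else (c ⟨e, he⟩).castSucc
    have extend {u : E → Y} (hm : Function.Injective (u ∘ m))
        (hc : Function.Injective fun e : {e // e ∉ Set.range m} => (u e, c e)) :
        Function.Injective fun e => (u e, c' e) := by
      intro e e' h
      obtain ⟨hu, hcc⟩ := Prod.mk.inj h
      by_cases he : e ∈ Set.range m <;> by_cases he' : e' ∈ Set.range m <;>
        simp only [c', he, he', dif_pos, dif_neg, not_false_eq_true] at hcc
      · obtain ⟨y, rfl⟩ := he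
        obtain ⟨y', rfl⟩ := he'
        rw [hm hu]
      · exact absurd hcc.symm (Fin.castSucc_ne_last _)
      · exact absurd hcc (Fin.castSucc_ne_last _)
      · exact congrArg Subtype.val
          (@hc ⟨e, he⟩ ⟨e', he'⟩ (Prod.ext hu (Fin.castSucc_injective _ hcc)))
    exact ⟨c', extend hsm.injective hsc, extend htm.injective htc⟩

end EdgeColouring

section ProductPermutations

variable {ι : Type*} {V : ι → Type*}

/-- The map `ρ` changes at most the `i`-th coordinate. -/
def ChangesOnly (i : ι) (ρ : (∀ i, V i) → ∀ i, V i) : Prop :=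
  ∀ x j, j ≠ i → ρ x j = x j

theorem ncard_preimage_snd_piSplitAt [DecidableEq ι] (i : ι) (y : ∀ j : {j // j ≠ i}, V j) :
    ((fun x => (Equiv.piSplitAt i V x).2) ⁻¹' {y}).ncard = Nat.card (V i) := by
  have : (fun x => (Equiv.piSplitAt i V x).2) ⁻¹' {y} =
      Equiv.piSplitAt i V ⁻¹' (Set.univ ×ˢ {y}) := by
    ext x
    simp
  rw [this, Set.ncard_preimage_of_injective_subset_range (Equiv.injective _) (by simp),
    Set.ncard_prod, Set.ncard_univ, Set.ncard_singleton, mul_one]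

theorem injective_update_of_injective_prodMk [DecidableEq ι] {X : Type*} {i : ι}
    {u : X → ∀ i, V i} {c : X → V i}
    (h : Function.Injective fun x => ((Equiv.piSplitAt i V (u x)).2, c x)) :
    Function.Injective fun x => Function.update (u x) i (c x) := by
  intro x y hxy
  refine h (Prod.ext (funext fun j => ?_) ?_)
  · simpa [j.2] using congrFun hxy j
  · simpa using congrFun hxy i

theorem exists_bijective_update [DecidableEq ι] [Finite ι] [∀ i, Finite (V i)] (i : ι)
    (σ : Equiv.Perm (∀ i, V i)) : ∃ c : (∀ i, V i) → V i,
      (Function.Bijective fun x => Function.update x i (c x)) ∧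
      Function.Bijective fun x => Function.update (σ x) i (c x) := by
  let r (x : ∀ i, V i) := (Equiv.piSplitAt i V x).2
  have hσ (y : ∀ j : {j // j ≠ i}, V j) : ((r ∘ σ) ⁻¹' {y}).ncard = Nat.card (V i) := by
    rw [Set.preimage_comp, Set.ncard_preimage_of_injective_subset_range σ.injective (by simp),
      ncard_preimage_snd_piSplitAt]
  obtain ⟨c, hc, hcσ⟩ := exists_edgeColouring (ncard_preimage_snd_piSplitAt i) hσ
  let e := (Finite.equivFin (V i)).symm
  refine ⟨e ∘ c, Finite.injective_iff_bijective.1 (injective_update_of_injective_prodMk ?_),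
    Finite.injective_iff_bijective.1 (injective_update_of_injective_prodMk ?_)⟩
  · exact (Function.injective_id.prodMap e.injective).comp hc
  · exact (Function.injective_id.prodMap e.injective).comp hcσ

theorem exists_eq_mul_mul_changesOnly [Finite ι] [∀ i, Finite (V i)] (i : ι)
    (σ : Equiv.Perm (∀ i, V i)) : ∃ α β γ : Equiv.Perm (∀ i, V i), σ = γ * β * α ∧
      ChangesOnly i α ∧ ChangesOnly i γ ∧ (∀ x, β x i = x i) ∧
      ∀ j, (∀ x, σ x j = x j) → ∀ x, β x j = x j := by
  classical
  obtain ⟨c, hαbij, hδbij⟩ := exists_bijective_update i σ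
  let α := Equiv.ofBijective _ hαbij
  let δ := Equiv.ofBijective _ hδbij
  have hα (x) : α x = Function.update x i (c x) := rfl
  have hβ (x) : (δ * α⁻¹) (α x) = Function.update (σ x) i (c x) := by
    simp [δ]
  refine ⟨α, δ * α⁻¹, σ * δ⁻¹, by group, fun x j hj => Function.update_of_ne hj _ _,
    fun x j hj => ?_, fun x => ?_, fun j hj x => ?_⟩
  · obtain ⟨x, rfl⟩ := δ.surjective x
    simp [δ, hj]
  · obtain ⟨x, rfl⟩ := α.surjective x
    rw [hβ, hα]
    simp
  · obtain ⟨x, rfl⟩ := α.surjective x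
    rw [hβ, hα]
    obtain rfl | hji := eq_or_ne j i
    · simp
    · simp [hji, hj]

theorem exists_list_changesOnly_prod_eq [Finite ι] [∀ i, Finite (V i)] {S : Finset ι}
    (hS : S.Nonempty) (σ : Equiv.Perm (∀ i, V i)) (hσ : ∀ j ∉ S, ∀ x, σ x j = x j) :
    ∃ l : List (Equiv.Perm (∀ i, V i)), l.length + 1 = 2 * S.card ∧ l.prod = σ ∧
      ∀ ρ ∈ l, ∃ i, ChangesOnly i ρ := by
  induction hS using Finset.Nonempty.cons_induction generalizing σ with
  | singleton i =>
    refine ⟨[σ], by simp, by simp, ?_⟩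
    simp only [List.mem_singleton, forall_eq]
    exact ⟨i, fun x j hj => hσ j (by simpa using hj) x⟩
  | cons i S hi _ ih =>
    obtain ⟨α, β, γ, rfl, hα, hγ, hβi, hβ⟩ := exists_eq_mul_mul_changesOnly i σ
    obtain ⟨l, hl, rfl, hmem⟩ := ih β fun j hj => by
      obtain rfl | hji := eq_or_ne j i
      · exact hβi
      · exact hβ j (hσ j (by simp [hji, hj]))
    refine ⟨γ :: (l ++ [α]), ?_, by simp [mul_assoc], ?_⟩
    · simp only [List.length_cons, List.length_append, List.length_nil, Finset.card_cons]
      omega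
    · simp only [List.mem_cons, List.mem_append, List.not_mem_nil, or_false]
      rintro ρ (rfl | h | rfl)
      exacts [⟨i, hγ⟩, hmem ρ h, ⟨i, hα⟩]

theorem exists_perm_sameCycle_iff {X Y : Type*} [Countable X] (g : X → Y) :
    ∃ σ : Equiv.Perm X, ∀ x y, σ.SameCycle x y ↔ g x = g y := by
  choose f hf _ using fun y => (Set.countable_univ (α := {x // g x = y})).exists_cycleOn
  let φ : (∀ y, Equiv.Perm {x // g x = y}) →* Equiv.Perm X :=
    (Equiv.sigmaFiberEquiv g).permCongrHom.toMonoidHom.comp (Equiv.Perm.sigmaCongrRightHom _)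
  have hφ (n : ℤ) (x : X) : (φ f ^ n) x = (f (g x) ^ n) ⟨x, rfl⟩ := by
    rw [← map_zpow]
    rfl
  refine ⟨φ f, fun x y => ⟨?_, fun hxy => ?_⟩⟩
  · rintro ⟨n, rfl⟩
    rw [hφ]
    exact ((f (g x) ^ n) ⟨x, rfl⟩).2.symm
  · obtain ⟨n, hn⟩ := (hf (g x)).2 (Set.mem_univ ⟨x, rfl⟩) (Set.mem_univ ⟨y, hxy.symm⟩)
    exact ⟨n, by rw [hφ, hn]⟩

end ProductPermutations

section Routing

variable {X Z : Type*} {K : SimpleGraph Z}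

/-- The graph `K` contains disjoint connected sets, the fibres of `l`, such that the set
with index `x` contains `f x` and `g x`. -/
structure Linked (K : SimpleGraph Z) (l : Z → Option X) (f g : X → Z) : Prop where
  conn : FiberConnected K l
  left : ∀ x, l (f x) = some x
  right : ∀ x, l (g x) = some x

theorem Linked.comp {l : Z → Option X} {f g : X → Z} (h : Linked K l f g) (τ : Equiv.Perm X) :
    Linked K (fun z => (l z).bind (some ∘ τ.symm)) (f ∘ τ) (g ∘ τ) :=
  ⟨h.conn.bind_of_injOn (by simp), fun x => by simp [h.left], fun x => by simp [h.right]⟩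

theorem linked_partialInv {f : X → Z} (hf : Function.Injective f) :
    Linked K (Function.partialInv f) f f :=
  ⟨fiberConnected_partialInv hf, Function.partialInv_left hf, Function.partialInv_left hf⟩

/-- One can route from the position `f x` to the position `g x`, for all `x` simultaneously,
through `n` consecutive copies of `K`. -/
inductive Routable (K : SimpleGraph Z) : ℕ → (X → Z) → (X → Z) → Prop
  | nil (f : X → Z) : Routable K 0 f f
  | cons {n : ℕ} {f g h : X → Z} {l : Z → Option X} (hl : Linked K l f g) (hr : Routable K n g h) :
      Routable K (n + 1) f h

theorem Routable.trans {m n : ℕ} {f g h : X → Z} (h₁ : Routable K m f g) (h₂ : Routable K n g h) :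
    Routable K (m + n) f h := by
  induction h₁ with
  | nil => simpa using h₂
  | cons hl _ ih =>
    rw [Nat.add_right_comm]
    exact .cons hl (ih h₂)

theorem Routable.comp {n : ℕ} {f g : X → Z} (h : Routable K n f g) (τ : Equiv.Perm X) :
    Routable K n (f ∘ τ) (g ∘ τ) := by
  induction h with
  | nil => exact .nil _
  | cons hl _ ih => exact .cons (hl.comp τ) ih

theorem Routable.mono {m n : ℕ} (hmn : m ≤ n) {f g : X → Z} (hf : Function.Injective f)
    (h : Routable K m f g) : Routable K n f g := by
  induction hmn with
  | refl => exact h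
  | step _ ih => exact .cons (linked_partialInv hf) ih

theorem Routable.exists_labelling {n : ℕ} {f g : X → Z} (h : Routable K n f g) :
    ∃ (l : ℕ → Z → Option X) (p : ℕ → X → Z), p 0 = f ∧ p n = g ∧
      ∀ t < n, Linked K (l t) (p t) (p (t + 1)) := by
  induction h with
  | nil f => exact ⟨fun _ _ => none, fun _ => f, rfl, rfl, by simp⟩
  | @cons n f g h l hl _ ih =>
    obtain ⟨l', p, h0, hn, hp⟩ := ih
    refine ⟨fun t => Nat.casesOn t l l', fun t => Nat.casesOn t f p, rfl, hn, fun t ht => ?_⟩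
    cases t with
    | zero => simpa [h0] using hl
    | succ t => exact hp t (by omega)

theorem cycleGraph_adj_add_one {n : ℕ} (u : Fin (n + 2)) :
    (SimpleGraph.cycleGraph (n + 2)).Adj u (u + 1) := by
  simp [SimpleGraph.cycleGraph_adj]

theorem Routable.exists_fiberConnected_cycleGraph {n : ℕ} {f g : X → Z}
    (h : Routable K (n + 2) f g) : ∃ l : Fin (n + 2) × Z → Option X,
      FiberConnected (SimpleGraph.cycleGraph (n + 2) □ K) l ∧ (∀ x, l (0, f x) = some x) ∧
      ∀ x, l (Fin.last _, g x) = some x := by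
  obtain ⟨l, p, rfl, rfl, hl⟩ := h.exists_labelling
  let L (a : Fin (n + 2) × Z) : Option X := l a.1 a.2
  have within {x} {t : Fin (n + 2)} {z z'} (hz : L (t, z) = some x) (hz' : L (t, z') = some x) :
      (fiberGraph (SimpleGraph.cycleGraph (n + 2) □ K) L x).Reachable (t, z) (t, z') :=
    reachable_fiberGraph_map (SimpleGraph.boxProdRight _ K t).toHom (fun _ ha => ha)
      ((hl t t.2).conn hz hz')
  have from_start (x) (t : Fin (n + 2)) :
      (fiberGraph (SimpleGraph.cycleGraph (n + 2) □ K) L x).Reachable (0, p 0 x) (t, p t x) := by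
    induction t using Fin.induction with
    | zero => rfl
    | succ t ih =>
      have hright : L (t.castSucc, p (t + 1) x) = some x := (hl t (by omega)).right x
      have hleft : L (t.succ, p (t + 1) x) = some x := (hl (t + 1) (by omega)).left x
      refine ih.trans ((within ((hl t (by omega)).left x) hright).trans
        (reachable_fiberGraph_of_adj ?_ hright hleft))
      refine SimpleGraph.boxProd_adj_left.2 ?_
      rw [← Fin.coeSucc_eq_succ]
      exact cycleGraph_adj_add_one _
  refine ⟨L, fun x a b ha hb => ?_, fun x => (hl 0 (by omega)).left x, fun x =>
    (hl (n + 1) (by omega)).right x⟩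
  have from_start_of_eq {c : Fin (n + 2) × Z} (hc : L c = some x) :
      (fiberGraph (SimpleGraph.cycleGraph (n + 2) □ K) L x).Reachable (0, p 0 x) c :=
    (from_start x c.1).trans (within ((hl c.1 c.1.2).left x) hc)
  exact (from_start_of_eq ha).symm.trans (from_start_of_eq hb)

theorem fiberConnected_fromRel_of_sameCycle_iff {Y : Type*} {σ : Equiv.Perm X} {g : X → Y}
    (hσ : ∀ x y, σ.SameCycle x y ↔ g x = g y) :
    FiberConnected (SimpleGraph.fromRel fun x y => σ x = y) fun x => some (g x) := by
  intro w x y hx hy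
  have hpow (n : ℤ) : some (g ((σ ^ n) x)) = some w :=
    (congrArg some ((hσ x _).1 ⟨n, rfl⟩)).symm.trans hx
  have step (n : ℤ) : (fiberGraph (SimpleGraph.fromRel fun x y => σ x = y)
      (fun x => some (g x)) w).Reachable ((σ ^ n) x) ((σ ^ (n + 1)) x) := by
    obtain h | h := eq_or_ne ((σ ^ n) x) ((σ ^ (n + 1)) x)
    · rw [← h]
    · refine reachable_fiberGraph_of_adj ⟨h, .inl ?_⟩ (hpow _) (hpow _)
      rw [add_comm, zpow_one_add, Equiv.Perm.mul_apply]
  obtain ⟨n, rfl⟩ := (hσ x y).2 (Option.some.inj (hx.trans hy.symm))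
  induction n using Int.induction_on with
  | zero => rfl
  | succ n ih => exact (ih (hpow _)).trans (step n)
  | pred n ih =>
    have := step (-n - 1)
    rw [sub_add_cancel] at this
    exact (ih (hpow _)).trans this.symm

/-- For every partition of `X` there are disjoint connected sets in `Q`, one for each class of the
partition, containing the positions `q x` of the members `x` of the class. -/
def Mergeable (Q : SimpleGraph Z) (q : X → Z) : Prop :=
  ∀ r : Setoid X, ∃ l : Z → Option (Quotient r), FiberConnected Q l ∧ ∀ x, l (q x) = some ⟦x⟧

theorem Mergeable.exists_labelling {Q : SimpleGraph Z} {q : X → Z} (hq : Mergeable Q q)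
    {Y : Type*} (g : X → Y) :
    ∃ l : Z → Option Y, FiberConnected Q l ∧ ∀ x, l (q x) = some (g x) := by
  obtain ⟨l, hl, hlq⟩ := hq (Setoid.ker g)
  exact ⟨_, hl.bind_of_injOn (g := some ∘ Setoid.kerLift g) fun u v w hu hv =>
    Setoid.kerLift_injective g (Option.some.inj (Eq.trans hu (Eq.symm hv))), fun x =>
      by simp [hlq, Setoid.kerLift]⟩

theorem mergeable_of_routable [Countable X] {n : ℕ} {f : X → Z}
    (h : ∀ σ : Equiv.Perm X, Routable K (n + 2) f (f ∘ σ)) :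
    Mergeable (SimpleGraph.cycleGraph (n + 2) □ K) fun x => ((0 : Fin (n + 2)), f x) := by
  intro r
  obtain ⟨σ, hσ⟩ := exists_perm_sameCycle_iff (Quotient.mk r)
  obtain ⟨l, hl, hstart, hend⟩ := (h σ).exists_fiberConnected_cycleGraph
  have wrap (x) : (SimpleGraph.cycleGraph (n + 2) □ K).Adj (Fin.last _, f (σ x)) (0, f (σ x)) := by
    rw [SimpleGraph.boxProd_adj_left, ← Fin.last_add_one]
    exact cycleGraph_adj_add_one _
  refine ⟨_, hl.bind (fiberConnected_fromRel_of_sameCycle_iff hσ) ?_, fun x => by simp [hstart]⟩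
  rintro x y ⟨-, rfl | rfl⟩
  · exact ⟨_, _, hend x, hstart (σ x), wrap x⟩
  · exact ⟨_, _, hstart (σ y), hend y, (wrap y).symm⟩

end Routing

section Merging

variable {X Z T W E : Type*} {A : SimpleGraph T} {Q : SimpleGraph Z} {a b : T}

theorem Mergeable.comp_injective {X' : Type*} {q : X → Z} (hq : Mergeable Q q) {p : X' → X}
    (hp : Function.Injective p) : Mergeable Q (q ∘ p) := by
  intro r
  obtain ⟨l, hl, hlq⟩ :=
    hq.exists_labelling fun x => (Function.partialInv p x).map (Quotient.mk r)
  exact ⟨_, hl.bind_of_injOn (g := id) fun u v w (hu : u = _) (hv : v = _) => hu.trans hv.symm,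
    fun x => by simp [hlq, Function.partialInv_left hp]⟩

open Classical in
/-- The labelling of the layers `{a} × Q` and `{b} × Q` of a product by `la` and `lb`. -/
noncomputable def twoLayers (a b : T) (la lb : Z → Option W) (t : T × Z) : Option W :=
  if t.1 = a then la t.2 else if t.1 = b then lb t.2 else none

theorem twoLayers_left (la lb : Z → Option W) (z : Z) : twoLayers a b la lb (a, z) = la z :=
  if_pos rfl

theorem twoLayers_right (hab : a ≠ b) (la lb : Z → Option W) (z : Z) :
    twoLayers a b la lb (b, z) = lb z :=
  (if_neg hab.symm).trans (if_pos rfl)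

theorem FiberConnected.twoLayers (hab : A.Adj a b) {la : Z → Option W} {lb : Z → Option E}
    {φ : E → W} (hla : FiberConnected Q la) (hlb : FiberConnected Q lb)
    (hφ : ∀ e, ∃ z, lb z = some e ∧ la z = some (φ e)) :
    FiberConnected (A □ Q) (twoLayers a b la fun z => (lb z).map φ) := by
  set F := ProductMinors.twoLayers a b la fun z => (lb z).map φ with hF
  have hFa (z) : F (a, z) = la z := twoLayers_left _ _ z
  have hFb (z) : F (b, z) = (lb z).map φ := twoLayers_right hab.ne _ _ z
  have within_left {w z z'} (hz : la z = some w) (hz' : la z' = some w) :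
      (fiberGraph (A □ Q) F w).Reachable (a, z) (a, z') :=
    reachable_fiberGraph_map (SimpleGraph.boxProdRight A Q a).toHom
      (fun z (hz : la z = _) => (hFa z).trans hz) (hla hz hz')
  have to_left {w t} (ht : F t = some w) :
      ∃ z, la z = some w ∧ (fiberGraph (A □ Q) F w).Reachable t (a, z) := by
    obtain ⟨c, z⟩ := t
    obtain rfl | hca := eq_or_ne c a
    · exact ⟨z, (hFa z).symm.trans ht, .rfl⟩
    obtain rfl | hcb := eq_or_ne c b
    · rw [hFb] at ht
      obtain ⟨e, hze, rfl⟩ := Option.map_eq_some_iff.1 ht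
      obtain ⟨z', hz'e, hz'⟩ := hφ e
      have hFz' : F (c, z') = some (φ e) := by rw [hFb, hz'e, Option.map_some]
      refine ⟨z', hz', .trans ?_ (reachable_fiberGraph_of_adj
        (SimpleGraph.boxProd_adj_left.2 hab.symm) hFz' ((hFa z').trans hz'))⟩
      exact reachable_fiberGraph_map (SimpleGraph.boxProdRight A Q c).toHom
        (fun z (hz : lb z = _) => (hFb z).trans (by rw [hz, Option.map_some])) (hlb hze hz'e)
    · simp [hF, ProductMinors.twoLayers, hca, hcb] at ht
  intro w x y hx hy
  obtain ⟨z, hz, hxz⟩ := to_left hx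
  obtain ⟨z', hz', hyz'⟩ := to_left hy
  exact hxz.trans ((within_left hz hz').trans hyz'.symm)

theorem exists_dart_edge_eq (H : SimpleGraph W) (e : H.edgeSet) : ∃ d : H.Dart, d.edge = e := by
  obtain ⟨e, he⟩ := e
  induction e with
  | _ x y => exact ⟨⟨(x, y), he⟩, rfl⟩

/-- In one layer the darts are merged according to their initial vertex, in the other one according
to their edge, and the branch set of a vertex also gets half of the edges at this vertex. -/
theorem Mergeable.exists_isModel {H : SimpleGraph W}
    (hH : ∀ w, ∃ w', H.Adj w w') (hab : A.Adj a b) {q : H.Dart → Z} (hq : Mergeable Q q) :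
    ∃ f, IsModel H (A □ Q) f := by
  obtain ⟨la, hla, hlaq⟩ := hq.exists_labelling fun d => d.fst
  obtain ⟨lb, hlb, hlbq⟩ := hq.exists_labelling fun d =>
    (⟨d.edge, d.edge_mem⟩ : H.edgeSet)
  choose r hr using exists_dart_edge_eq H
  have hFa (d : H.Dart) : twoLayers a b la (fun z => (lb z).map fun e => (r e).fst) (a, q d) =
      some d.fst := (twoLayers_left _ _ _).trans (hlaq d)
  have hFb (d : H.Dart) : twoLayers a b la (fun z => (lb z).map fun e => (r e).fst) (b, q d) =
      some (r ⟨d.edge, d.edge_mem⟩).fst := by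
    rw [twoLayers_right hab.ne, hlbq, Option.map_some]
  have hadj (z : Z) : (A □ Q).Adj (a, z) (b, z) := SimpleGraph.boxProd_adj_left.2 hab
  refine ⟨_, fun w => ?_, hla.twoLayers hab hlb fun e => ⟨q (r e), ?_, hlaq _⟩, fun {w w'} hw => ?_⟩
  · obtain ⟨w', hw⟩ := hH w
    exact ⟨_, hFa ⟨(w, w'), hw⟩⟩
  · exact (hlbq _).trans (congrArg some (Subtype.ext (hr e)))
  · let d : H.Dart := ⟨(w, w'), hw⟩
    obtain h | h := (SimpleGraph.dart_edge_eq_iff _ d).1 (hr ⟨d.edge, d.edge_mem⟩)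
    · refine ⟨(b, q d.symm), (a, q d.symm), ?_, hFa d.symm, (hadj _).symm⟩
      simp only [hFb, SimpleGraph.Dart.edge_symm, h]
      rfl
    · exact ⟨(a, q d), (b, q d), hFa d, (hFb d).trans (by rw [h]; rfl), hadj _⟩

theorem natCard_dart {W : Type*} [Finite W] (H : SimpleGraph W) :
    Nat.card H.Dart = 2 * H.edgeSet.ncard := by
  classical
  have := Fintype.ofFinite W
  rw [Nat.card_eq_fintype_card, H.dart_card_eq_twice_card_edges, ← SimpleGraph.coe_edgeFinset,
    Set.ncard_coe_finset]

theorem nonempty_embedding_of_natCard_le {α β : Type*} [Finite α] [Finite β]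
    (h : Nat.card α ≤ Nat.card β) : Nonempty (α ↪ β) := by
  have := Fintype.ofFinite α
  have := Fintype.ofFinite β
  exact Function.Embedding.nonempty_of_card_le (by simpa only [Nat.card_eq_fintype_card] using h)

theorem Mergeable.isMinorUniversal [Finite X] [Finite Z] [Finite T] {q : X → Z}
    (hq : Mergeable Q q) (hab : A.Adj a b) : IsMinorUniversal (A □ Q) (Nat.card X / 2) := by
  intro W _ H hH hm
  have hdart : Nat.card H.Dart ≤ Nat.card X := by
    rw [natCard_dart]
    rw [le_div_iff₀ two_pos, mul_comm] at hm
    exact_mod_cast hm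
  have : Finite H.Dart := .of_injective _ SimpleGraph.Dart.toProd_injective
  obtain ⟨p⟩ := nonempty_embedding_of_natCard_le hdart
  obtain ⟨f, hf⟩ := (hq.comp_injective p.injective).exists_isModel hH hab
  exact hf.isMinor

end Merging

section Layers

variable {ι : Type*} {V : ι → Type*} {Y : Type*} {H : SimpleGraph Y} {G : ∀ i, SimpleGraph (V i)}

theorem linked_fst (hH : H.Connected) (a b : (∀ i, V i) → Y) :
    Linked (H □ boxPi G) (fun z => some z.2) (fun x => (a x, x)) (fun x => (b x, x)) := by
  refine ⟨.of_forall_exists_hom hH fun x => ⟨(SimpleGraph.boxProdLeft H _ x).toHom, fun _ => rfl,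
    ?_⟩, fun x => rfl, fun x => rfl⟩
  rintro ⟨h, y⟩ hy
  obtain rfl := Option.some.inj hy
  exact ⟨h, rfl⟩

/-- The `i`-th factor of a product as the column through the vertex `x`. -/
def columnHom [DecidableEq ι] (i : ι) (x : ∀ i, V i) : G i →g boxPi G where
  toFun := Function.update x i
  map_rel' hab := ⟨i, by simpa using hab, fun j hj => by simp [hj]⟩

theorem columnHom_apply [DecidableEq ι] (i : ι) (x : ∀ i, V i) (a : V i) :
    columnHom (G := G) i x a = Function.update x i a :=
  rfl

/-- In the layer over `e a`, each column in direction `i` is labelled by its vertex with `i`-th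
coordinate `a`. -/
theorem linked_changesOnly [DecidableEq ι] {i : ι} (hG : (G i).Connected) {e : V i → Y}
    (he : Function.Injective e) {ρ : (∀ i, V i) → ∀ i, V i} (hρ : ChangesOnly i ρ) :
    Linked (H □ boxPi G) (fun z => (Function.partialInv e z.1).map (Function.update z.2 i))
      (fun x => (e (x i), x)) (fun x => (e (x i), ρ x)) := by
  have hl (x y : ∀ i, V i) (hy : ∀ j ≠ i, y j = x j) :
      (Function.partialInv e (e (x i))).map (Function.update y i) = some x := by
    rw [Function.partialInv_left he, Option.map_some, Option.some_inj]
    exact Function.update_eq_iff.2 ⟨rfl, hy⟩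
  refine ⟨.of_forall_exists_hom hG fun x => ⟨(SimpleGraph.boxProdRight H _ (e (x i))).toHom.comp
    (columnHom i x), fun a => hl x _ fun j hj => Function.update_of_ne hj _ _, ?_⟩,
    fun x => hl x x fun _ _ => rfl, fun x => hl x (ρ x) (hρ x)⟩
  rintro ⟨h, y⟩ hy
  obtain ⟨a, ha, rfl⟩ := Option.map_eq_some_iff.1 hy
  obtain rfl := (he.isPartialInv _ _).1 ha
  exact ⟨y i, by simp [columnHom_apply]⟩

theorem routable_of_changesOnly (hH : H.Connected) {i : ι} (hG : (G i).Connected) {e : V i → Y}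
    (he : Function.Injective e) {ρ : Equiv.Perm (∀ i, V i)} (hρ : ChangesOnly i ρ) (h₀ : Y) :
    Routable (H □ boxPi G) 3 (fun x => (h₀, x)) (fun x => (h₀, ρ x)) := by
  classical
  have hback := (linked_fst (G := G) hH (fun x => e (ρ.symm x i)) fun _ => h₀).comp ρ
  simp only [Function.comp_def, Equiv.symm_apply_apply] at hback
  exact .cons (linked_fst hH (fun _ => h₀) fun x => e (x i))
    (.cons (linked_changesOnly hG he hρ) (.cons hback (.nil _)))

theorem routable_list_prod (hH : H.Connected) (hG : ∀ i, (G i).Connected) {e : ∀ i, V i → Y}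
    (he : ∀ i, Function.Injective (e i)) (h₀ : Y) (l : List (Equiv.Perm (∀ i, V i)))
    (hl : ∀ ρ ∈ l, ∃ i, ChangesOnly i ρ) :
    Routable (H □ boxPi G) (3 * l.length) (fun x => (h₀, x)) ((fun x => (h₀, x)) ∘ l.prod) := by
  induction l with
  | nil => exact .nil _
  | cons ρ l ih =>
    obtain ⟨i, hi⟩ := hl ρ List.mem_cons_self
    rw [List.length_cons, mul_add]
    exact (ih fun ρ' hρ' => hl ρ' (List.mem_cons_of_mem _ hρ')).trans
      ((routable_of_changesOnly hH (hG i) (he i) hi h₀).comp l.prod)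

theorem routable_perm [Finite ι] [Nonempty ι] [∀ i, Finite (V i)] (hH : H.Connected)
    (hG : ∀ i, (G i).Connected) {e : ∀ i, V i → Y} (he : ∀ i, Function.Injective (e i)) (h₀ : Y)
    {n : ℕ} (hn : 6 * Nat.card ι ≤ n + 3) (σ : Equiv.Perm (∀ i, V i)) :
    Routable (H □ boxPi G) n (fun x => (h₀, x)) ((fun x => (h₀, x)) ∘ σ) := by
  have := Fintype.ofFinite ι
  obtain ⟨l, hl, rfl, hmem⟩ := exists_list_changesOnly_prod_eq Finset.univ_nonempty σ (by simp)
  rw [Finset.card_univ, ← Nat.card_eq_fintype_card] at hl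
  exact (routable_list_prod hH hG he h₀ l hmem).mono (by omega) (Prod.mk_right_injective h₀)

theorem isMinorUniversal_cycleGraph_boxProd {T : Type*} [Finite T] {A : SimpleGraph T} {a b : T}
    (hab : A.Adj a b) [Finite ι] [Nonempty ι] [∀ i, Finite (V i)] [Finite Y] (hH : H.Connected)
    (hG : ∀ i, (G i).Connected) (hV : ∀ i, Nat.card (V i) ≤ Nat.card Y) {m : ℕ} (hm₁ : 1 < m)
    (hm : 6 * Nat.card ι ≤ m + 3) :
    IsMinorUniversal (A □ (SimpleGraph.cycleGraph m □ (H □ boxPi G)))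
      (Nat.card (∀ i, V i) / 2) := by
  obtain ⟨n, rfl⟩ := Nat.exists_eq_add_of_le' hm₁
  obtain ⟨h₀⟩ := hH.nonempty
  let e (i : ι) : V i ↪ Y := (nonempty_embedding_of_natCard_le (hV i)).some
  exact (mergeable_of_routable
    (routable_perm hH hG (fun i => (e i).injective) h₀ hm)).isMinorUniversal hab

end Layers

section Levels

open Complex Finset MeasureTheory

theorem integral_exp_int_mul_I (m : ℤ) :
    ∫ θ in (-Real.pi)..Real.pi, exp (m * I * θ) = if m = 0 then 2 * Real.pi else 0 := by
  split_ifs with h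
  · subst h
    simp only [Int.cast_zero, zero_mul, exp_zero, intervalIntegral.integral_const, real_smul,
      mul_one]
    push_cast
    ring
  · rw [integral_exp_mul_complex (by simp [h, I_ne_zero]), ofReal_zero, div_eq_zero_iff,
      sub_eq_zero, exp_eq_exp_iff_exists_int]
    exact .inl ⟨m, by push_cast; ring⟩

theorem two_pi_mul_card_fiber_le {Ω : Type*} [Fintype Ω] (φ : Ω → ℤ) (j : ℤ) :
    2 * Real.pi * #{ω | φ ω = j} ≤
      ∫ θ in (-Real.pi)..Real.pi, ‖∑ ω, exp (φ ω * I * θ)‖ := by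
  have hcoeff : ((2 * Real.pi * #{ω | φ ω = j} : ℝ) : ℂ) =
      ∫ θ in (-Real.pi)..Real.pi, exp (-(j * θ : ℝ) * I) * ∑ ω, exp (φ ω * I * θ) := by
    have hmul (θ : ℝ) : exp (-(j * θ : ℝ) * I) * ∑ ω, exp (φ ω * I * θ) =
        ∑ ω, exp ((φ ω - j : ℤ) * I * θ) := by
      rw [mul_sum]
      refine sum_congr rfl fun ω _ => ?_
      rw [← exp_add]
      push_cast
      ring_nf
    simp_rw [hmul]
    rw [intervalIntegral.integral_finsetSum fun ω _ =>
      Continuous.intervalIntegrable (by fun_prop) _ _]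
    simp_rw [integral_exp_int_mul_I, sub_eq_zero]
    rw [← ofReal_sum, ← sum_filter, sum_const, nsmul_eq_mul, mul_comm]
  calc 2 * Real.pi * (#{ω | φ ω = j} : ℝ)
      = ‖((2 * Real.pi * #{ω | φ ω = j} : ℝ) : ℂ)‖ := by
        rw [norm_real, Real.norm_of_nonneg (by positivity)]
    _ ≤ ∫ θ in (-Real.pi)..Real.pi, ‖exp (-(j * θ : ℝ) * I) * ∑ ω, exp (φ ω * I * θ)‖ := by
        rw [hcoeff]
        exact intervalIntegral.norm_integral_le_integral_norm (by linarith [Real.pi_pos])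
    _ = ∫ θ in (-Real.pi)..Real.pi, ‖∑ ω, exp (φ ω * I * θ)‖ := by
        simp_rw [norm_mul, ← ofReal_neg, norm_exp_ofReal_mul_I, one_mul]

theorem sum_exp_card_filter_eq {ι α : Type*} [Fintype ι] [DecidableEq ι] [Fintype α]
    [DecidableEq α] (a : α) (θ : ℝ) :
    ∑ y : ι → α, exp (#{i | y i = a} * I * θ) =
      ((Fintype.card α : ℝ) - 1 + exp (θ * I)) ^ Fintype.card ι := by
  have hsum : ∑ b : α, (if b = a then exp (θ * I) else 1) =
      (Fintype.card α : ℝ) - 1 + exp (θ * I) := by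
    rw [sum_ite, sum_const, sum_const, filter_eq', if_pos (mem_univ a), filter_ne',
      card_erase_of_mem (mem_univ a), card_univ, nsmul_eq_mul, nsmul_eq_mul,
      Nat.cast_pred (Fintype.card_pos_iff.2 ⟨a⟩)]
    simp [add_comm]
  rw [← hsum, ← Finset.card_univ, ← prod_const, Fintype.prod_sum]
  refine sum_congr rfl fun y _ => ?_
  rw [prod_ite, prod_const, prod_const_one, mul_one, ← exp_nat_mul]
  ring_nf

theorem norm_sub_one_add_exp_le {k : ℝ} (hk : 2 ≤ k) {θ : ℝ} (hθ : |θ| ≤ Real.pi) :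
    ‖(k : ℂ) - 1 + exp (θ * I)‖ ≤ k * Real.exp (-(θ ^ 2 / (Real.pi ^ 2 * k))) := by
  have : 0 < k := by linarith
  have hnormSq : normSq ((k : ℂ) - 1 + exp (θ * I)) = k ^ 2 - 2 * (k - 1) * (1 - Real.cos θ) := by
    rw [exp_mul_I, ← ofReal_cos, ← ofReal_sin, ← add_assoc, ← ofReal_one, ← ofReal_sub,
      ← ofReal_add, normSq_add_mul_I]
    linear_combination Real.sin_sq_add_cos_sq θ
  refine le_of_sq_le_sq ?_ (by positivity)
  calc ‖(k : ℂ) - 1 + exp (θ * I)‖ ^ 2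
      = k ^ 2 - 2 * (k - 1) * (1 - Real.cos θ) := by rw [← normSq_eq_norm_sq, hnormSq]
    _ ≤ k ^ 2 - k * (2 / Real.pi ^ 2 * θ ^ 2) := by
        have hcos := Real.cos_le_one_sub_mul_cos_sq hθ
        gcongr <;> linarith
    _ = k ^ 2 * (-(2 * (θ ^ 2 / (Real.pi ^ 2 * k))) + 1) := by
        have := Real.pi_ne_zero
        field_simp
        ring
    _ ≤ k ^ 2 * Real.exp (-(2 * (θ ^ 2 / (Real.pi ^ 2 * k)))) := by
        gcongr
        exact Real.add_one_le_exp _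
    _ = (k * Real.exp (-(θ ^ 2 / (Real.pi ^ 2 * k)))) ^ 2 := by
        rw [mul_pow, ← Real.exp_nat_mul, Nat.cast_ofNat, mul_neg]

theorem integral_norm_sub_one_add_exp_pow_le {k : ℝ} (hk : 2 ≤ k) {n : ℕ} (hn : n ≠ 0) :
    ∫ θ in (-Real.pi)..Real.pi, ‖(k : ℂ) - 1 + exp (θ * I)‖ ^ n ≤
      2 * Real.pi * (√k * k ^ n / √n) := by
  have : 0 < k := by linarith
  have : (0 : ℝ) < n := by positivity
  have hπ : -Real.pi ≤ Real.pi := by linarith [Real.pi_pos]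
  set c := n / (Real.pi ^ 2 * k) with hc
  calc ∫ θ in (-Real.pi)..Real.pi, ‖(k : ℂ) - 1 + exp (θ * I)‖ ^ n
      ≤ ∫ θ in (-Real.pi)..Real.pi, k ^ n * Real.exp (-c * θ ^ 2) := by
        refine intervalIntegral.integral_mono_on hπ
          (Continuous.intervalIntegrable (by fun_prop) _ _)
          (Continuous.intervalIntegrable (by fun_prop) _ _) fun θ hθ => ?_
        refine (pow_le_pow_left₀ (norm_nonneg _)
          (norm_sub_one_add_exp_le hk (abs_le.2 hθ)) n).trans_eq ?_
        rw [mul_pow, ← Real.exp_nat_mul, hc]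
        ring_nf
    _ = k ^ n * ∫ θ in (-Real.pi)..Real.pi, Real.exp (-c * θ ^ 2) :=
        intervalIntegral.integral_const_mul _ _
    _ ≤ k ^ n * ∫ θ : ℝ, Real.exp (-c * θ ^ 2) := by
        gcongr
        rw [intervalIntegral.integral_of_le hπ]
        exact setIntegral_le_integral (integrable_exp_neg_mul_sq (by positivity))
          (.of_forall fun θ => (Real.exp_pos _).le)
    _ = k ^ n * (Real.pi * √(Real.pi * k) / √n) := by
        rw [integral_gaussian, ← Real.sqrt_sq Real.pi_pos.le, ← Real.sqrt_mul (by positivity),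
          ← Real.sqrt_div (by positivity), Real.sqrt_sq Real.pi_pos.le, hc]
        field_simp
    _ ≤ k ^ n * (Real.pi * √(4 * k) / √n) := by
        have := Real.pi_le_four
        gcongr
    _ = 2 * Real.pi * (√k * k ^ n / √n) := by
        rw [Real.sqrt_mul zero_le_four, show (4 : ℝ) = 2 ^ 2 by norm_num,
          Real.sqrt_sq zero_le_two]
        ring

theorem card_level_le {ι α : Type*} [Fintype ι] [DecidableEq ι] [Nonempty ι] [Fintype α]
    [DecidableEq α] [Nontrivial α] (a : α) (j : ℕ) :
    (#{y : ι → α | #{i | y i = a} = j} : ℝ) ≤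
      √(Fintype.card α) * Fintype.card α ^ Fintype.card ι / √(Fintype.card ι) := by
  refine le_of_mul_le_mul_left ?_ Real.two_pi_pos
  calc 2 * Real.pi * (#{y : ι → α | #{i | y i = a} = j} : ℝ)
      ≤ ∫ θ in (-Real.pi)..Real.pi, ‖∑ y : ι → α, exp (#{i | y i = a} * I * θ)‖ := by
        simpa using two_pi_mul_card_fiber_le (fun y : ι → α => (#{i | y i = a} : ℤ)) j
    _ = ∫ θ in (-Real.pi)..Real.pi,
          ‖((Fintype.card α : ℝ) : ℂ) - 1 + exp (θ * I)‖ ^ Fintype.card ι := by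
        simp_rw [sum_exp_card_filter_eq, norm_pow]
    _ ≤ _ := integral_norm_sub_one_add_exp_pow_le
        (by exact_mod_cast Fintype.one_lt_card) Fintype.card_ne_zero

end Levels

section Separation

open Finset

variable {V W : Type*}

/-- Any two disjoint sets, each with at least a quarter of the vertices, are joined by an edge. -/
def JoinsQuarters (H : SimpleGraph W) : Prop :=
  ∀ A B : Set W, Disjoint A B → Nat.card W ≤ 4 * A.ncard → Nat.card W ≤ 4 * B.ncard →
    ∃ a ∈ A, ∃ b ∈ B, H.Adj a b

theorem pow_mul_card_piFinset_compl_le [Fintype W] [DecidableEq W] {A B : Finset W}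
    (hA : Fintype.card W ≤ 4 * #A) (hB : Fintype.card W ≤ 4 * #B) (N : ℕ) :
    16 ^ N * #(Fintype.piFinset fun _ : Fin N => (A ×ˢ B)ᶜ) ≤
      15 ^ N * (Fintype.card W ^ 2) ^ N := by
  rw [Fintype.card_piFinset_const, ← mul_pow, ← mul_pow]
  refine Nat.pow_le_pow_left ?_ N
  have hcompl := card_add_card_compl (A ×ˢ B)
  rw [card_product, Fintype.card_prod] at hcompl
  nlinarith [Nat.mul_le_mul hA hB]

/-- A union bound: there are at most `4 ^ M` products of two quarters, where `M` is the number of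
elements, `22 * M` random pairs miss a given one of them with probability at most
`(15 / 16) ^ (22 * M)`, and `4 * (15 / 16) ^ 22 < 1`. -/
theorem exists_finset_forall_inter_product_nonempty (W : Type*) [Fintype W] [DecidableEq W]
    [Nonempty W] : ∃ P : Finset (W × W), #P ≤ 22 * Fintype.card W ∧
      ∀ A B : Finset W, Fintype.card W ≤ 4 * #A → Fintype.card W ≤ 4 * #B →
        (P ∩ A ×ˢ B).Nonempty := by
  set M := Fintype.card W with hM
  suffices ∃ f : Fin (22 * M) → W × W, ∀ A B : Finset W, M ≤ 4 * #A → M ≤ 4 * #B →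
      ∃ i, f i ∈ A ×ˢ B by
    obtain ⟨f, hf⟩ := this
    refine ⟨univ.image f, card_image_le.trans_eq (by simp), fun A B hA hB => ?_⟩
    obtain ⟨i, hi⟩ := hf A B hA hB
    exact ⟨f i, mem_inter.2 ⟨mem_image_of_mem f (mem_univ i), hi⟩⟩
  by_contra! hmiss
  let Q : Finset (Finset W × Finset W) := {P | M ≤ 4 * #P.1 ∧ M ≤ 4 * #P.2}
  have hQ : #Q ≤ 4 ^ M := (card_filter_le _ _).trans_eq (by simp [← mul_pow, hM])
  have hcover : univ ⊆ Q.biUnion fun P => Fintype.piFinset fun _ : Fin (22 * M) =>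
      (P.1 ×ˢ P.2)ᶜ := by
    intro f _
    obtain ⟨A, B, hA, hB, hf⟩ := hmiss f
    exact mem_biUnion.2 ⟨(A, B), by simp [Q, hA, hB],
      Fintype.mem_piFinset.2 fun i => mem_compl.2 (hf i)⟩
  have hcount : 16 ^ (22 * M) * (M ^ 2) ^ (22 * M) ≤
      4 ^ M * 15 ^ (22 * M) * (M ^ 2) ^ (22 * M) := by
    calc 16 ^ (22 * M) * (M ^ 2) ^ (22 * M)
        = 16 ^ (22 * M) * #(univ : Finset (Fin (22 * M) → W × W)) := by simp [sq, hM]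
      _ ≤ ∑ P ∈ Q, 16 ^ (22 * M) * #(Fintype.piFinset fun _ : Fin (22 * M) =>
            (P.1 ×ˢ P.2)ᶜ) := by
          rw [← mul_sum]
          exact Nat.mul_le_mul_left _ ((card_le_card hcover).trans card_biUnion_le)
      _ ≤ #Q * (15 ^ (22 * M) * (M ^ 2) ^ (22 * M)) := by
          refine sum_le_card_nsmul _ _ _ fun P hP => ?_
          obtain ⟨hA, hB⟩ := (mem_filter.1 hP).2
          exact pow_mul_card_piFinset_compl_le hA hB _
      _ ≤ 4 ^ M * 15 ^ (22 * M) * (M ^ 2) ^ (22 * M) := by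
          rw [← mul_assoc]
          gcongr
  have hM₀ : M ≠ 0 := Fintype.card_ne_zero
  have hpow := Nat.le_of_mul_le_mul_right hcount (by positivity)
  rw [pow_mul, pow_mul, ← mul_pow] at hpow
  exact hpow.not_gt (Nat.pow_lt_pow_left (by norm_num) hM₀)

theorem exists_joinsQuarters (W : Type*) [Finite W] [Nontrivial W] :
    ∃ H : SimpleGraph W, (∀ w, ∃ w', H.Adj w w') ∧ H.edgeSet.ncard ≤ 23 * Nat.card W ∧
      JoinsQuarters H := by
  classical
  have := Fintype.ofFinite W
  obtain ⟨P, hPcard, hP⟩ := exists_finset_forall_inter_product_nonempty W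
  obtain ⟨o, o', hoo'⟩ := exists_pair_ne W
  let S : Finset (Sym2 W) := P.image (fun p => s(p.1, p.2)) ∪ univ.image fun w => s(o, w)
  let H := SimpleGraph.fromEdgeSet (S : Set (Sym2 W))
  have hstar (w : W) (hw : o ≠ w) : H.Adj o w :=
    (SimpleGraph.fromEdgeSet_adj _).2
      ⟨mem_union_right _ (mem_image_of_mem (fun w => s(o, w)) (mem_univ w)), hw⟩
  refine ⟨H, fun w => ?_, ?_, fun A B hAB hA hB => ?_⟩
  · obtain rfl | hw := eq_or_ne o w
    exacts [⟨o', hstar o' hoo'⟩, ⟨o, (hstar w hw).symm⟩]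
  · calc H.edgeSet.ncard ≤ #S := by
          rw [SimpleGraph.edgeSet_fromEdgeSet, ← Set.ncard_coe_finset]
          exact Set.ncard_le_ncard Set.sdiff_subset (finite_toSet _)
      _ ≤ 22 * Fintype.card W + Fintype.card W :=
        (card_union_le _ _).trans (add_le_add (card_image_le.trans hPcard) card_image_le)
      _ = 23 * Nat.card W := by rw [Nat.card_eq_fintype_card]; ring
  · rw [Nat.card_eq_fintype_card, Set.ncard_eq_toFinset_card'] at hA hB
    obtain ⟨⟨v, w⟩, hvw⟩ := hP _ _ hA hB
    simp only [mem_inter, mem_product, Set.mem_toFinset] at hvw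
    exact ⟨v, hvw.2.1, w, hvw.2.2, (SimpleGraph.fromEdgeSet_adj _).2
      ⟨mem_union_left _ (mem_image_of_mem (fun p : W × W => s(p.1, p.2)) hvw.1),
        hAB.ne_of_mem hvw.2.1 hvw.2.2⟩⟩

variable {G : SimpleGraph V} {f : V → Option W} {φ : V → ℕ}

/-- The labels all of whose vertices have level less than `j`. -/
def labelsBelow (f : V → Option W) (φ : V → ℕ) (j : ℕ) : Set W :=
  {w | ∀ x, f x = some w → φ x < j}

/-- The labels of the vertices of level `j`. -/
def labelsAt (f : V → Option W) (φ : V → ℕ) (j : ℕ) : Set W :=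
  {w | ∃ x, f x = some w ∧ φ x = j}

/-- The labels all of whose vertices have level greater than `j`. -/
def labelsAbove (f : V → Option W) (φ : V → ℕ) (j : ℕ) : Set W :=
  {w | ∀ x, f x = some w → j < φ x}

theorem ncard_labelsAt_le [Finite V] (f : V → Option W) (φ : V → ℕ) (j : ℕ) :
    (labelsAt f φ j).ncard ≤ {x | φ x = j}.ncard := by
  rw [← Set.ncard_image_of_injective _ (Option.some_injective _)]
  refine (Set.ncard_le_ncard ?_ (Set.toFinite _)).trans (Set.ncard_image_le (f := f))
  rintro _ ⟨w, ⟨x, hx, hj⟩, rfl⟩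
  exact ⟨x, hj, hx⟩

theorem labelsBelow_succ_subset (f : V → Option W) (φ : V → ℕ) (j : ℕ) :
    labelsBelow f φ (j + 1) ⊆ labelsBelow f φ j ∪ labelsAt f φ j := by
  intro w hw
  by_contra! hw'
  simp only [Set.mem_union, not_or] at hw'
  exact hw'.1 fun x hx => (Nat.lt_succ_iff.1 (hw x hx)).lt_of_ne fun hj => hw'.2 ⟨x, hx, hj⟩

theorem FiberConnected.labelsBelow_union_labelsAt_union_labelsAbove (hf : FiberConnected G f)
    (hφ : ∀ x y, G.Adj x y → φ y ≤ φ x + 1) (j : ℕ) :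
    labelsBelow f φ j ∪ labelsAt f φ j ∪ labelsAbove f φ j = Set.univ := by
  refine Set.eq_univ_of_forall fun w => ?_
  by_contra hw
  simp only [labelsBelow, labelsAt, labelsAbove, Set.mem_union, Set.mem_ofPred_eq, not_or,
    not_forall, not_lt, not_exists, not_and] at hw
  obtain ⟨⟨⟨y, hy, hjy⟩, hne⟩, x, hx, hxj⟩ := hw
  have stays_below {u v : V} (huv : (fiberGraph G f w).Reachable u v) (hu : φ u < j) :
      φ v < j := by
    obtain ⟨p⟩ := huv
    induction p with
    | nil => exact hu
    | cons hadj _ ih =>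
      exact ih (((hφ _ _ hadj.1).trans hu).lt_of_ne (hne _ hadj.2.2))
  exact hjy.not_gt (stays_below (hf hx hy) (hxj.lt_of_ne (hne x hx)))

theorem exists_labelsBelow_lt_le [Finite V] (hf : ∀ w, ∃ x, f x = some w) (φ : V → ℕ) {m : ℕ}
    (hm : 0 < m) (hmW : m ≤ 4 * Nat.card W) :
    ∃ j, 4 * (labelsBelow f φ j).ncard < m ∧ m ≤ 4 * (labelsBelow f φ (j + 1)).ncard := by
  have hzero : labelsBelow f φ 0 = ∅ := Set.eq_empty_of_forall_notMem fun w hw =>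
    let ⟨x, hx⟩ := hf w
    (hw x hx).not_ge (Nat.zero_le _)
  have hexists : ∃ j, m ≤ 4 * (labelsBelow f φ j).ncard := by
    obtain ⟨b, hb⟩ := (Set.finite_range φ).bddAbove
    refine ⟨b + 1, ?_⟩
    rwa [show labelsBelow f φ (b + 1) = Set.univ from Set.eq_univ_of_forall fun w x _ =>
      Nat.lt_succ_of_le (hb ⟨x, rfl⟩), Set.ncard_univ]
  classical
  obtain ⟨j, hj⟩ : ∃ j, Nat.find hexists = j + 1 := Nat.exists_eq_succ_of_ne_zero fun h => by
    have := Nat.find_spec hexists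
    rw [h, hzero, Set.ncard_empty] at this
    omega
  exact ⟨j, not_le.1 (Nat.find_min hexists (by omega)), hj ▸ Nat.find_spec hexists⟩

theorem JoinsQuarters.not_isMinor_of_levels [Finite V] [Finite W] [Nonempty W]
    {H : SimpleGraph W} (hH : JoinsQuarters H) (hφ : ∀ x y, G.Adj x y → φ y ≤ φ x + 1)
    (hlevel : ∀ j, 4 * {x | φ x = j}.ncard ≤ Nat.card W) : ¬ IsMinor H G := by
  intro hminor
  obtain ⟨f, hf⟩ := hminor.exists_isModel
  obtain ⟨j, hlt, hle⟩ :=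
    exists_labelsBelow_lt_le hf.surj φ (m := Nat.card W) Nat.card_pos (by omega)
  have hsplit : Nat.card W ≤ (labelsBelow f φ (j + 1)).ncard + (labelsAt f φ (j + 1)).ncard +
      (labelsAbove f φ (j + 1)).ncard := by
    rw [← Set.ncard_univ, ← hf.conn.labelsBelow_union_labelsAt_union_labelsAbove hφ (j + 1)]
    exact (Set.ncard_union_le _ _).trans (Nat.add_le_add_right (Set.ncard_union_le _ _) _)
  have hstep := (Set.ncard_le_ncard (labelsBelow_succ_subset f φ j)).trans
    (Set.ncard_union_le _ _)
  have hat₀ := ncard_labelsAt_le f φ j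
  have hat₁ := ncard_labelsAt_le f φ (j + 1)
  have hlevel₀ := hlevel j
  have hlevel₁ := hlevel (j + 1)
  have hdisj : Disjoint (labelsBelow f φ (j + 1)) (labelsAbove f φ (j + 1)) :=
    Set.disjoint_left.2 fun w hw hw' =>
      let ⟨x, hx⟩ := hf.surj w
      (hw x hx).not_gt (hw' x hx)
  obtain ⟨v, hv, w, hw, hvw⟩ := hH _ _ hdisj hle (by omega)
  obtain ⟨x, y, hx, hy, hxy⟩ := hf.adj hvw
  have hxj := hv x hx
  have hyj := hw y hy
  have hxy' := hφ x y hxy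
  omega

end Separation

section BoxPi

open Finset

theorem IsMinorUniversal.anti {V : Type*} {G : SimpleGraph V} {m m' : ℝ}
    (h : IsMinorUniversal G m') (hm : m ≤ m') : IsMinorUniversal G m :=
  fun W _ H hH hHm => h W H hH (hHm.trans hm)

variable {ι : Type*} {V : ι → Type*} {α : Type*}

theorem card_filter_le_of_boxPi_adj [Fintype ι] {G : ∀ i, SimpleGraph (V i)}
    (p : ∀ i, V i → Prop) [∀ i, DecidablePred (p i)] {x y : ∀ i, V i} (h : (boxPi G).Adj x y) :
    #{i | p i (y i)} ≤ #{i | p i (x i)} + 1 := by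
  classical
  obtain ⟨i, -, hi⟩ := h
  refine (card_le_card fun j hj => ?_).trans (card_insert_le i _)
  obtain rfl | hji := eq_or_ne j i
  · exact mem_insert_self _ _
  · exact mem_insert_of_mem (by simpa [hi j hji] using hj)

theorem ncard_level_le [Fintype ι] [Nonempty ι] [Fintype α] [DecidableEq α]
    [Nontrivial α] (e : ∀ i, V i ↪ α) (a : α) (j : ℕ) :
    ({x : ∀ i, V i | #{i | e i (x i) = a} = j}.ncard : ℝ) ≤
      √(Fintype.card α) * Fintype.card α ^ Fintype.card ι / √(Fintype.card ι) := by
  classical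
  refine le_trans ?_ (card_level_le a j)
  rw [Nat.cast_le, ← Set.ncard_coe_finset]
  exact Set.ncard_le_ncard_of_injOn (fun x i => e i (x i)) (fun x hx => by simpa using hx)
    (fun x _ y _ h => funext fun i => (e i).injective (congrFun h i)) (finite_toSet _)

theorem one_le_pow_div_sqrt {k n : ℕ} (hk : 2 ≤ k) (hn : n ≠ 0) :
    1 ≤ (k : ℝ) ^ n / √n := by
  have hn₁ : (1 : ℝ) ≤ n := by exact_mod_cast Nat.one_le_iff_ne_zero.2 hn
  rw [one_le_div (by positivity)]
  calc √n ≤ n := Real.sqrt_le_self_iff.2 (.inr hn₁)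
    _ ≤ k ^ n := by exact_mod_cast (Nat.lt_pow_self hk).le

theorem not_isMinorUniversal_boxPi {k : ℕ} (hk : 2 ≤ k) [Finite ι] [Nonempty ι]
    [∀ i, Finite (V i)] (G : ∀ i, SimpleGraph (V i)) (hV : ∀ i, Nat.card (V i) ≤ k) :
    ¬ IsMinorUniversal (boxPi G) (92 * (√k + 1) * k ^ Nat.card ι / √(Nat.card ι)) := by
  classical
  have := Fintype.ofFinite ι
  have : NeZero k := ⟨by omega⟩
  have : Nontrivial (Fin k) := Fin.nontrivial_iff_two_le.2 hk
  let e (i : ι) : V i ↪ Fin k :=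
    (nonempty_embedding_of_natCard_le ((hV i).trans_eq (Nat.card_fin k).symm)).some
  set n := Nat.card ι with hn
  have hn₀ : n ≠ 0 := Nat.card_pos.ne'
  set B := √k * k ^ n / √n with hB
  have hB₀ : 0 < B := by positivity
  have hceil : 0 < ⌈B⌉₊ := Nat.ceil_pos.2 hB₀
  have : Nontrivial (Fin (4 * ⌈B⌉₊)) := Fin.nontrivial_iff_two_le.2 (by omega)
  obtain ⟨H, hisolated, hedges, hjoins⟩ := exists_joinsQuarters (Fin (4 * ⌈B⌉₊))
  have hlevel (j : ℕ) : {x : ∀ i, V i | #{i | e i (x i) = 0} = j}.ncard ≤ ⌈B⌉₊ := by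
    have h := ncard_level_le e 0 j
    rw [Fintype.card_fin, ← Nat.card_eq_fintype_card, ← hn, ← hB] at h
    exact_mod_cast h.trans (Nat.le_ceil B)
  intro huniv
  refine hjoins.not_isMinor_of_levels
    (fun x y hxy => card_filter_le_of_boxPi_adj (fun i v => e i v = 0) hxy)
    (fun j => by simpa using hlevel j) (huniv _ H hisolated ?_)
  calc (H.edgeSet.ncard : ℝ) ≤ 92 * ⌈B⌉₊ := by
        rw [Nat.card_fin, ← mul_assoc] at hedges
        exact_mod_cast hedges
    _ ≤ 92 * (B + k ^ n / √n) := by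
        gcongr
        linarith [Nat.ceil_lt_add_one hB₀.le, one_le_pow_div_sqrt hk hn₀]
    _ = 92 * (√k + 1) * k ^ n / √n := by rw [hB]; ring

end BoxPi

end ProductMinors

open ProductMinors SimpleGraph in
theorem theoremB_general :
    (∀ (ι : Type*) [Finite ι] [Nonempty ι] (V : ι → Type*) [∀ i, Finite (V i)]
        (G : ∀ i, SimpleGraph (V i)) (T : Type*) [Finite T] (A : SimpleGraph T) (Y : Type*)
        [Finite Y] (H : SimpleGraph Y) (m : ℕ),
        (∀ i, Nat.card (V i) ≤ Nat.card Y) → (∀ i, (G i).Connected) → A ≠ ⊥ → H.Connected →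
        1 < m → 6 * Nat.card ι ≤ m + 3 →
        IsMinorUniversal (A □ (cycleGraph m □ (H □ boxPi G))) (Nat.card (∀ i, V i) / 2)) ∧
    ∀ k : ℕ, 2 ≤ k → ∃ C : ℝ, 0 < C ∧
      ∀ (ι : Type*) [Finite ι] [Nonempty ι] (V : ι → Type*) [∀ i, Finite (V i)]
        (G : ∀ i, SimpleGraph (V i)), (∀ i, Nat.card (V i) ≤ k) →
        ¬ IsMinorUniversal (boxPi G) (C * k ^ Nat.card ι / √(Nat.card ι)) := by
  refine ⟨fun ι _ _ V _ G T _ A Y _ H m hV hG hA hH hm₁ hm => ?_, fun k hk =>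
    ⟨92 * (√k + 1), by positivity, fun ι _ _ V _ G hV => not_isMinorUniversal_boxPi hk G hV⟩⟩
  obtain ⟨a, b, hab⟩ := ne_bot_iff_exists_adj.1 hA
  exact isMinorUniversal_cycleGraph_boxProd hab hH hG hV hm₁ hm

theorem theoremB (k : ℕ) :
    (∀ (n : ℕ), 1 ≤ n →
      ∀ (V : Fin n → Type*) [∀ i, Finite (V i)] (G : ∀ i, SimpleGraph (V i))
        (W₄ : Type*) [Finite W₄] (H₄ : SimpleGraph W₄)
        (Wₖ : Type*) [Finite Wₖ] (Hₖ : SimpleGraph Wₖ),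
        (∀ i, Nat.card (V i) ≤ k) → (∀ i, (G i).Connected) →
        Nat.card W₄ = 4 → H₄.Connected →
        Nat.card Wₖ = k → Hₖ.Connected →
        ProductMinors.IsMinorUniversal
          (H₄.boxProd ((SimpleGraph.cycleGraph (6 * n - 2)).boxProd
            (Hₖ.boxProd (ProductMinors.boxPi G))))
          ((1 / 16 : ℝ) * ∏ i, (Nat.card (V i) : ℝ))) ∧
    (2 ≤ k → ∃ C : ℝ, 0 < C ∧ ∀ (n : ℕ), 1 ≤ n →
      ∀ (V : Fin n → Type*) [∀ i, Finite (V i)] (G : ∀ i, SimpleGraph (V i)),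
        (∀ i, Nat.card (V i) ≤ k) →
        ¬ ProductMinors.IsMinorUniversal (ProductMinors.boxPi G)
          (C * (k : ℝ) ^ n / Real.sqrt n)) := by
  refine ⟨fun n hn V _ G W₄ _ H₄ Wₖ _ Hₖ hV hG h₄ hH₄ hₖ hHₖ => ?_, fun hk => ?_⟩
  · have : NeZero n := ⟨by omega⟩
    have : Nontrivial W₄ := Finite.one_lt_card_iff_nontrivial.1 (by omega)
    have hne : H₄ ≠ ⊥ := SimpleGraph.ne_bot_iff_exists_adj.2 <| hH₄.nonempty.elim fun a =>
      ⟨a, hH₄.preconnected.exists_adj_of_nontrivial a⟩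
    refine (theoremB_general.{0, _, _, _, 0, 0}.1 (Fin n) V G W₄ H₄ Wₖ Hₖ (6 * n - 2)
      (by simpa only [hₖ] using hV) hG hne hHₖ (by omega) (by rw [Nat.card_fin]; omega)).anti ?_
    rw [Nat.card_pi, Nat.cast_prod]
    have : 0 ≤ ∏ i, (Nat.card (V i) : ℝ) := by positivity
    linarith
  · obtain ⟨C, hC, hnot⟩ := theoremB_general.{0, 0, 0, 0, 0, _}.2 k hk
    refine ⟨C, hC, fun n hn V _ G hV => ?_⟩
    have : NeZero n := ⟨by omega⟩
    simpa only [Nat.card_fin] using hnot (Fin n) V G hV
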